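/- **Lemma (Finite detectability of distances).** *Setting.* A finite-state generalized semi-Markov process (GSMP) has a finite set $S$ of states; for each state $s$ a finite set $I(s)$ of active events, each with its own clock, which runs down at a constant rate $r_{s,i}>0$; a set $\mathrm{Props}(s)$ of atomic propositions; for $i\in I(s)$ a transition probability $\mathrm{next}_i(s,\cdot)$ on $S$; and for $i\in I(s)$, $s'\in S$, $i'\in I(s')$ a continuous probability density $f(\cdot\,;s,i;s',i')$ on $[0,\infty)$. A *configuration* is a pair $\langle s,c\rangle$ with $c\in[0,\infty)^{I(s)}$; it is a *generalized state* if exactly one clock reaches $0$ first, i.e. $i\mapsto c_i/r_{s,i}$ has a unique minimizer; its *firing time* is $T\langle s,c\rangle=\min_i c_i/r_{s,i}$. Let $\mathcal G$ be the set of generalized states, with its Borel $\sigma$-algebra as a subset of $\bigsqcup_s[0,\infty)^{I(s)}$. From a generalized state $\langle s,c\rangle$, after time $T\langle s,c\rangle$ the first event $i$ fires, the next state $s'$ is drawn from $\mathrm{next}_i(s,\cdot)$, the clocks in $I(s')\cap(I(s)\setminus\{i\})$ keep their current values, and the other clocks $i'\in I(s')$ are set independently with densities $f(\cdot\,;s,i;s',i')$.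 This defines a discrete-time Markov process. A *trace* is a sequence $\omega$ in $\mathcal G$ with $\sum_n T(\omega_n)=\infty$. With $\sigma_n=\sum_{j<n}T(\omega_j)$ it generates the function $f_\omega:[0,\infty)\to\mathcal G$ that on $[\sigma_n,\sigma_{n+1})$ equals $\omega_n$ with its clocks run down for the time $t-\sigma_n$. Let $\mathrm{Traces}(g)$ be the law of the process started at $g\in\mathcal G$, restricted to the set of traces. A *pseudometric* takes values in $[0,1]$ and satisfies $m(x,x)=0$, symmetry and the triangle inequality; $m\preceq m'$ means $m(x,y)\ge m'(x,y)$ for all $x,y$. For a pseudometric $m$ on $\mathcal G$ and traces $\omega,\omega'$ with generated functions $f,f'$ put $$J(m)(\omega,\omega')=\max\Big(\sup_t\inf_{t'}\max\big(m(f(t),f'(t')),|t-t'|\big),\ \sup_{t'}\inf_{t}\max\big(m(f(t),f'(t')),|t-t'|\big)\Big),$$ and for finite measures $P,Q$ on the set of traces let $$W(J(m))(P,Q)=\sup_h\Big(\int h\,dP-\int h\,dQ\Big),$$ the supremum being over all measurable $h$ with values in $[0,1]$ and $|h(\omega)-h(\omega')|\le J(m)(\omega,\omega')$ for all traces $\omega,\omega'$.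 For $0<k<1$ let $$\mathcal F_k(m)(g,g')=k\cdot W(J(m))(\mathrm{Traces}(g),\mathrm{Traces}(g')).$$ *Statement.* Let $0<k<1$, and let $m$ be a pseudometric on $\mathcal G$ whose topology has a countable basis, such that $x\mapsto m(a,x)$ is Borel measurable for every $a\in\mathcal G$, and such that the function $f_\omega$ generated by any trace $\omega$ is cadlag (right continuous with left limits in $\mathcal G$) with respect to $m$. Let $g,g'\in\mathcal G$ and $\delta\in\mathbb R$ with $\mathcal F_k(m)(g,g')>\delta$. Then there are a finite subset $\mathcal G_{fin}\subseteq\mathcal G$ and $\varepsilon>0$ such that every pseudometric $m'\succeq m$ on $\mathcal G$ with $$m'(a,b)\ \ge\ m(a,b)-\varepsilon\qquad\text{for all }a,b\in\mathcal G_{fin}$$ satisfies $\mathcal F_k(m')(g,g')>\delta$. -/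

import Mathlib

open MeasureTheory ProbabilityTheory Set Filter Topology
open scoped NNReal ENNReal

noncomputable section

/-! ### Pseudometrics bounded by one -/

/-- A pseudometric on `X` with values in `[0,1]`. -/
structure PMetric (X : Type*) where
  d : X → X → ℝ
  nonneg : ∀ x y, 0 ≤ d x y
  le_one : ∀ x y, d x y ≤ 1
  self : ∀ x, d x x = 0
  symm : ∀ x y, d x y = d y x
  triangle : ∀ x y z, d x z ≤ d x y + d y z

namespace PMetric

variable {X : Type*}

/-- The order on pseudometrics: `m₁ ⪯ m₂` iff `m₁ ≥ m₂` pointwise (so the top is the zero one). -/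
def Preceq (m₁ m₂ : PMetric X) : Prop := ∀ x y, m₂.d x y ≤ m₁.d x y

/-- The pseudometric as a Mathlib `PseudoMetricSpace`. -/
abbrev toPseudoMetricSpace (m : PMetric X) : PseudoMetricSpace X where
  dist := m.d
  dist_self := m.self
  dist_comm := m.symm
  dist_triangle := m.triangle

/-- The topology on `X` induced by the pseudometric. -/
abbrev topology (m : PMetric X) : TopologicalSpace X :=
  m.toPseudoMetricSpace.toUniformSpace.toTopologicalSpace

/-- The topology induced by the pseudometric has a countable basis. -/
def HasCountableBasis (m : PMetric X) : Prop := @SecondCountableTopology X m.topology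

/-- `f : [0,∞) → (X,m)` is right continuous and has left limits. -/
def IsCadlag (m : PMetric X) (f : ℝ≥0 → X) : Prop :=
  ∀ t₀ : ℝ≥0, Tendsto f (𝓝[>] t₀) (@nhds X m.topology (f t₀)) ∧
    ∃ x : X, Tendsto f (𝓝[<] t₀) (@nhds X m.topology x)

end PMetric

/-- The Skorohod `J₂` distance `J(m)(f,g)` of two functions on `[0,∞)`: the Hausdorff distance of
their graphs for the metric `max (m(x,y)) |t - t'|`. -/
def skorohodJ {X : Type*} (m : PMetric X) (f g : ℝ≥0 → X) : ℝ :=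
  max (⨆ t : ℝ≥0, ⨅ t' : ℝ≥0, max (m.d (f t) (g t')) (dist t t'))
    (⨆ t' : ℝ≥0, ⨅ t : ℝ≥0, max (m.d (f t) (g t')) (dist t t'))

/-- The Wasserstein distance `W(d)(P,Q)`, as the supremum of `∫ h dP - ∫ h dQ` over all
(measurable) `h : Ω → [0,1]` with `|h x - h y| ≤ d x y`. -/
def wasserstein {Ω : Type*} [MeasurableSpace Ω] (d : Ω → Ω → ℝ) (P Q : Measure Ω) : ℝ :=
  sSup {r : ℝ | ∃ h : Ω → ℝ, Measurable h ∧ (∀ x, 0 ≤ h x ∧ h x ≤ 1) ∧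
    (∀ x y, |h x - h y| ≤ d x y) ∧ r = ∫ x, h x ∂P - ∫ x, h x ∂Q}

/-! ### Generalized semi-Markov processes -/

/-- Lebesgue measure on `[0,∞)`. -/
def lebesgueNN : Measure ℝ≥0 := Measure.comap ((↑) : ℝ≥0 → ℝ) volume

/-- A finite-state generalized semi-Markov process over atomic propositions `AP`, with states `S`
and events (= clocks) taken from `E`. All data are only relevant for events that are active
(`i ∈ I s`, and `i' ∈ I s'`) in the states concerned. -/
structure GSMP (AP S E : Type*) [Fintype S] where
  /-- the finite set of events active in a state -/
  I : S → Finset E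
  /-- the rate at which the clock of an event runs down in a state -/
  rate : S → E → ℝ≥0
  rate_pos : ∀ s, ∀ i ∈ I s, 0 < rate s i
  /-- the atomic propositions true in a state -/
  props : S → Set AP
  /-- `density s i s' i'` is the density of the new value of clock `i'`
  when event `i` leads from `s` to `s'` -/
  density : S → E → S → E → ℝ≥0 → ℝ≥0
  density_continuous : ∀ s, ∀ i ∈ I s, ∀ s', ∀ i' ∈ I s', Continuous (density s i s' i')
  density_integral : ∀ s, ∀ i ∈ I s, ∀ s', ∀ i' ∈ I s',
    ∫⁻ t, (density s i s' i' t : ℝ≥0∞) ∂lebesgueNN = 1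
  /-- `next i s s'` is the probability that event `i` leads from `s` to `s'` -/
  next : E → S → S → ℝ≥0
  next_sum : ∀ s, ∀ i ∈ I s, ∑ s', next i s s' = 1

namespace GSMP

variable {AP S E : Type*} [Fintype S] (M : GSMP AP S E)

/-- A configuration `⟨s, c⟩`: a state with a vector of clock values indexed by the active events.
It carries the Borel σ-algebra of the disjoint union of the orthants `[0,∞)^(I s)`. -/
abbrev Config : Type _ := Σ s : S, (M.I s → ℝ≥0)

/-- The time at which clock `i` reaches zero. -/
def hitTime (x : M.Config) (i : M.I x.1) : ℝ≥0 := x.2 i / M.rate x.1 i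

/-- Clock `i` is a clock that reaches zero first. -/
def IsFirst (x : M.Config) (i : M.I x.1) : Prop := ∀ j, M.hitTime x i ≤ M.hitTime x j

/-- A generalized state: a configuration with a unique clock that reaches zero first. -/
def IsGenState (x : M.Config) : Prop := ∃! i, M.IsFirst x i

/-- The set of generalized states. -/
abbrev GenState : Type _ := {x : M.Config // M.IsGenState x}

/-- The time required for the first clock to reach zero. -/
def fireTime (x : M.Config) : ℝ≥0 := ⨅ i, M.hitTime x i

/-- The configuration reached by running all clocks down at their rates for a time `t`
(stopped when the first clock reaches zero, so that the subtraction never truncates). -/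
def evolve (x : M.Config) (t : ℝ≥0) : M.Config :=
  ⟨x.1, fun i => x.2 i - M.rate x.1 i * min t (M.fireTime x)⟩

/-- The law of a newly set clock: clock `i'`, when event `i` has led from `s` to `s'`. -/
def resetLaw (s : S) (i : E) (s' : S) (i' : E) : Measure ℝ≥0 :=
  lebesgueNN.withDensity (fun t => (M.density s i s' i' t : ℝ≥0∞))

open Classical in
/-- The law of the value of clock `i' ∈ I s'` just after event `i` has led from `x` to the state
`s'`: clocks in `I s \ {i}` keep their current value, all others are set anew. -/
def clockLaw (x : M.Config) (i : M.I x.1) (s' : S) (i' : M.I s') : Measure ℝ≥0 :=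
  if h : (i' : E) ∈ M.I x.1 ∧ (i' : E) ≠ i then
    Measure.dirac ((M.evolve x (M.fireTime x)).2 ⟨i', h.1⟩)
  else M.resetLaw x.1 i s' i'

/-- The law of the configuration just after event `i` has occurred, starting from `x`: the next
state is chosen according to `next i`, and the new clocks are set independently. -/
def fireLaw (x : M.Config) (i : M.I x.1) : Measure M.Config :=
  ∑ s' : S, (M.next i x.1 s' : ℝ≥0∞) •
    (Measure.pi (fun i' : M.I s' => M.clockLaw x i s' i')).map
      (Sigma.mk (β := fun s => M.I s → ℝ≥0) s')

open Classical in
/-- One step of the embedded discrete-time Markov process: in a generalized state the unique first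
clock fires. A configuration that is not a generalized state is left unchanged; sequences that
visit one are not traces (see `Trace`). -/
def stepLaw (x : M.Config) : Measure M.Config :=
  if h : M.IsGenState x then M.fireLaw x h.choose else Measure.dirac x

/-! The step law is a Markov kernel. -/

variable {M}

lemma measurable_of_sigma {Y : Type*} [MeasurableSpace Y] {f : M.Config → Y}
    (hf : ∀ s, Measurable (fun c : M.I s → ℝ≥0 => f ⟨s, c⟩)) : Measurable f := by
  intro t ht
  refine MeasurableSpace.measurableSet_iInf.2 fun s => ?_
  exact hf s ht

lemma measurable_sigmaMk (s : S) :
    Measurable (Sigma.mk (β := fun s => M.I s → ℝ≥0) s : (M.I s → ℝ≥0) → M.Config) := by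
  intro t ht
  exact MeasurableSpace.measurableSet_iInf.1 ht s

lemma measurable_hitTime (s : S) (i : M.I s) :
    Measurable (fun c : M.I s → ℝ≥0 => M.hitTime ⟨s, c⟩ i) := by
  have h : Measurable (fun c : M.I s → ℝ≥0 => c i) := measurable_pi_apply i
  exact h.div_const (M.rate s i)

lemma measurable_fireTime : Measurable (M.fireTime) := by
  refine measurable_of_sigma fun s => ?_
  unfold fireTime
  exact Measurable.iInf fun i => measurable_hitTime s i

lemma measurableSet_isFirst (s : S) (i : M.I s) :
    MeasurableSet {c : M.I s → ℝ≥0 | M.IsFirst ⟨s, c⟩ i} := by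
  have : {c : M.I s → ℝ≥0 | M.IsFirst ⟨s, c⟩ i} =
      ⋂ j : M.I s, {c | M.hitTime ⟨s, c⟩ i ≤ M.hitTime ⟨s, c⟩ j} := by
    ext c; simp [IsFirst]
  rw [this]
  exact MeasurableSet.iInter fun j =>
    measurableSet_le (measurable_hitTime s i) (measurable_hitTime s j)

lemma measurableSet_isGenState : MeasurableSet {x : M.Config | M.IsGenState x} := by
  refine MeasurableSpace.measurableSet_iInf.2 fun s => ?_
  have : (Sigma.mk (β := fun s => M.I s → ℝ≥0) s ⁻¹'
      {x : M.Config | M.IsGenState x} : Set (M.I s → ℝ≥0)) =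
      ⋃ i : M.I s, ({c | M.IsFirst ⟨s, c⟩ i} ∩ ⋂ j : M.I s, ({c | M.IsFirst ⟨s, c⟩ j}ᶜ ∪ {_c | j = i})) := by
    ext c
    simp only [mem_preimage, mem_ofPred_eq, IsGenState, ExistsUnique, mem_iUnion, mem_inter_iff,
      mem_iInter, mem_union, mem_compl_iff]
    refine exists_congr fun i => and_congr_right fun _ => forall_congr' fun j => ?_
    tauto
  change MeasurableSet (Sigma.mk (β := fun s => M.I s → ℝ≥0) s ⁻¹'
      {x : M.Config | M.IsGenState x} : Set (M.I s → ℝ≥0))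
  rw [this]
  exact MeasurableSet.iUnion fun i => (measurableSet_isFirst s i).inter
    (MeasurableSet.iInter fun j => (measurableSet_isFirst s j).compl.union (MeasurableSet.const _))

lemma isProbabilityMeasure_resetLaw {s : S} {i : E} (hi : i ∈ M.I s) {s' : S} {i' : E}
    (hi' : i' ∈ M.I s') : IsProbabilityMeasure (M.resetLaw s i s' i') := by
  constructor
  rw [resetLaw, withDensity_apply _ MeasurableSet.univ, Measure.restrict_univ]
  exact M.density_integral s i hi s' i' hi'

instance (x : M.Config) (i : M.I x.1) (s' : S) (i' : M.I s') :
    IsProbabilityMeasure (M.clockLaw x i s' i') := by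
  unfold clockLaw
  split_ifs
  · infer_instance
  · exact isProbabilityMeasure_resetLaw i.2 i'.2

instance (x : M.Config) (i : M.I x.1) : IsProbabilityMeasure (M.fireLaw x i) := by
  constructor
  have h : ∀ s' : S, ((Measure.pi (fun i' : M.I s' => M.clockLaw x i s' i')).map
      (Sigma.mk (β := fun s => M.I s → ℝ≥0) s')) univ = 1 := fun s' => by
    rw [Measure.map_apply (measurable_sigmaMk s') MeasurableSet.univ]
    simp
  simp only [fireLaw, Measure.coe_finsetSum, Finset.sum_apply, Measure.smul_apply, h,
    smul_eq_mul, mul_one]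
  exact_mod_cast M.next_sum x.1 i i.2

instance (x : M.Config) : IsProbabilityMeasure (M.stepLaw x) := by
  unfold stepLaw
  split_ifs <;> infer_instance

lemma measurable_evolve (s : S) (j : M.I s) : Measurable
    (fun c : M.I s → ℝ≥0 => (M.evolve ⟨s, c⟩ (M.fireTime ⟨s, c⟩)).2 j) := by
  have h : Measurable (fun c : M.I s → ℝ≥0 => M.fireTime ⟨s, c⟩) :=
    measurable_fireTime.comp (measurable_sigmaMk s)
  simp only [evolve, min_self]
  exact (measurable_pi_apply j).sub (h.const_mul _)

lemma measurable_clockLaw (s : S) (i : M.I s) (s' : S) (i' : M.I s') :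
    Measurable (fun c : M.I s → ℝ≥0 => M.clockLaw ⟨s, c⟩ i s' i') := by
  by_cases h : (i' : E) ∈ M.I s ∧ (i' : E) ≠ i
  · have : (fun c : M.I s → ℝ≥0 => M.clockLaw ⟨s, c⟩ i s' i') = fun c =>
        Measure.dirac ((M.evolve ⟨s, c⟩ (M.fireTime ⟨s, c⟩)).2 ⟨i', h.1⟩) := by
      funext c; exact dif_pos h
    rw [this]
    exact Measure.measurable_dirac.comp (measurable_evolve (M := M) s ⟨(i' : E), h.1⟩)
  · have : (fun c : M.I s → ℝ≥0 => M.clockLaw ⟨s, c⟩ i s' i') = fun _ =>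
        M.resetLaw s i s' i' := by
      funext c; exact dif_neg h
    rw [this]
    exact measurable_const

lemma measurable_fireLaw (s : S) (i : M.I s) :
    Measurable (fun c : M.I s → ℝ≥0 => M.fireLaw ⟨s, c⟩ i) := by
  have hpi : ∀ s' : S, Measurable (fun c : M.I s → ℝ≥0 =>
      Measure.pi (fun i' : M.I s' => M.clockLaw ⟨s, c⟩ i s' i')) := fun s' => by
    refine Measurable.measure_of_isPiSystem_of_isProbabilityMeasure generateFrom_pi.symm
      isPiSystem_pi ?_
    rintro _ ⟨t, ht, rfl⟩
    simp only [Measure.pi_pi]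
    exact Finset.measurable_prod _ fun i' _ =>
      (Measure.measurable_coe (show MeasurableSet (t i') from ht i' (mem_univ i'))).comp (measurable_clockLaw s i s' i')
  refine Measure.measurable_of_measurable_coe _ fun t ht => ?_
  simp only [fireLaw, Measure.coe_finsetSum, Finset.sum_apply, Measure.smul_apply, smul_eq_mul]
  refine Finset.measurable_sum _ fun s' _ => Measurable.const_mul ?_ _
  exact (Measure.measurable_coe ht).comp
    ((Measure.measurable_map _ (measurable_sigmaMk s')).comp (hpi s'))

lemma measurable_stepLaw : Measurable (M.stepLaw) := by
  classical
  refine measurable_of_sigma fun s => ?_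
  have hG : MeasurableSet {c : M.I s → ℝ≥0 | M.IsGenState ⟨s, c⟩} :=
    measurable_sigmaMk s measurableSet_isGenState
  refine Measure.measurable_of_measurable_coe _ fun t ht => ?_
  have key : (fun c : M.I s → ℝ≥0 => M.stepLaw ⟨s, c⟩ t) = fun c =>
      if M.IsGenState ⟨s, c⟩ then
        ∑ i : M.I s, if M.IsFirst ⟨s, c⟩ i then M.fireLaw ⟨s, c⟩ i t else 0
      else Measure.dirac (⟨s, c⟩ : M.Config) t := by
    funext c
    unfold stepLaw
    split_ifs with h
    · rw [Finset.sum_eq_single (Exists.choose h)]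
      · rw [if_pos h.choose_spec.1]
      · intro j _ hj
        rw [if_neg fun hf => hj (h.choose_spec.2 j hf)]
      · simp
    · rfl
  rw [key]
  refine Measurable.ite hG ?_ ?_
  · exact Finset.measurable_sum _ fun i _ => Measurable.ite (measurableSet_isFirst s i)
      ((Measure.measurable_coe ht).comp (measurable_fireLaw s i)) measurable_const
  · exact (Measure.measurable_coe ht).comp (Measure.measurable_dirac.comp (measurable_sigmaMk s))

lemma hitTime_evolve (x : M.Config) (t : ℝ≥0) (i : M.I x.1) :
    M.hitTime (M.evolve x t) i = M.hitTime x i - min t (M.fireTime x) := by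
  have hr : M.rate x.1 i ≠ 0 := (M.rate_pos x.1 i i.2).ne'
  simp only [hitTime, evolve]
  rw [NNReal.sub_div, mul_div_cancel_left₀ _ hr]

lemma fireTime_le (x : M.Config) (i : M.I x.1) : M.fireTime x ≤ M.hitTime x i :=
  ciInf_le (OrderBot.bddBelow _) i

/-- Generalized states stay generalized states until the first clock reaches zero. -/
lemma isGenState_evolve {x : M.Config} (hx : M.IsGenState x) (t : ℝ≥0) :
    M.IsGenState (M.evolve x t) := by
  have h : ∀ i : M.I x.1, M.IsFirst (M.evolve x t) i ↔ M.IsFirst x i := fun i => by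
    refine forall_congr' fun j => ?_
    have hi := hitTime_evolve x t i
    have hj := hitTime_evolve x t j
    have h2 : min t (M.fireTime x) ≤ M.hitTime x j := (min_le_right _ _).trans (fireTime_le x j)
    refine (hi ▸ hj ▸ Iff.rfl : _ ↔
      M.hitTime x i - min t (M.fireTime x) ≤ M.hitTime x j - min t (M.fireTime x)).trans ?_
    exact (tsub_le_tsub_iff_right h2)
  obtain ⟨i, hi, hu⟩ := hx
  exact ⟨i, (h i).2 hi, fun j hj => hu j ((h j).1 hj)⟩

variable (M)

/-- The transition kernel of the embedded discrete-time Markov process. -/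
def stepKernel : Kernel M.Config M.Config := ⟨M.stepLaw, measurable_stepLaw⟩

instance : IsMarkovKernel M.stepKernel := ⟨fun x => inferInstanceAs
  (IsProbabilityMeasure (M.stepLaw x))⟩

/-- `stepKernel` as a kernel from histories up to time `n`. -/
def historyKernel (n : ℕ) : Kernel (Π _ : Finset.Iic n, M.Config) M.Config :=
  M.stepKernel.comap (fun h => h ⟨n, Finset.mem_Iic.2 le_rfl⟩) (measurable_pi_apply _)

instance (n : ℕ) : IsMarkovKernel (M.historyKernel n) := by
  unfold historyKernel; infer_instance

/-- The law of the sequence of configurations of the process started at `x`. -/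
def seqLaw (x : M.Config) : Measure (ℕ → M.Config) :=
  Kernel.traj (X := fun _ => M.Config) M.historyKernel 0 (fun _ => x)

/-! ### Traces -/

/-- The time at which the `n`-th generalized state of a sequence is entered. -/
def entryTime (ω : ℕ → M.GenState) (n : ℕ) : ℝ≥0 := ∑ k ∈ Finset.range n, M.fireTime (ω k).1

/-- A finitely varying (non-Zeno) sequence of generalized states. -/
abbrev Trace : Type _ := {ω : ℕ → M.GenState // Tendsto (M.entryTime ω) atTop atTop}

/-- The function `[0,∞) → GenState` generated by a trace: if `n` is the index such that
`entryTime n ≤ t < entryTime (n+1)`, the `n`-th generalized state evolved for the time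
`t - entryTime n`. -/
def path (τ : M.Trace) (t : ℝ≥0) : M.GenState :=
  let n := sInf {n : ℕ | t < M.entryTime τ.1 (n + 1)}
  ⟨M.evolve (τ.1 n).1 (t - M.entryTime τ.1 n), isGenState_evolve (τ.1 n).2 _⟩

/-- A trace as a sequence of configurations. -/
def traceVal (τ : M.Trace) : ℕ → M.Config := fun n => (τ.1 n).1

lemma measurableEmbedding_traceVal : MeasurableEmbedding M.traceVal := by
  have hmeas : ∀ n, Measurable fun ω : ℕ → M.Config =>
      ∑ k ∈ Finset.range n, M.fireTime (ω k) := fun n =>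
    Finset.measurable_sum _ fun k _ => measurable_fireTime.comp (measurable_pi_apply k)
  have hmono : ∀ ω : ℕ → M.Config, Monotone fun n =>
      ∑ k ∈ Finset.range n, M.fireTime (ω k) := fun ω a b hab =>
    Finset.sum_le_sum_of_subset (Finset.range_mono hab)
  have hrange : range M.traceVal = (⋂ n, {ω | M.IsGenState (ω n)}) ∩
      ⋂ N : ℕ, ⋃ n : ℕ, {ω | (N : ℝ≥0) ≤ ∑ k ∈ Finset.range n, M.fireTime (ω k)} := by
    ext ω
    simp only [mem_range, mem_inter_iff, mem_iInter, mem_ofPred_eq, mem_iUnion]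
    constructor
    · rintro ⟨τ, rfl⟩
      exact ⟨fun n => (τ.1 n).2, fun N => (tendsto_atTop.1 τ.2 (N : ℝ≥0)).exists⟩
    · rintro ⟨h1, h2⟩
      refine ⟨⟨fun n => ⟨ω n, h1 n⟩, ?_⟩, rfl⟩
      refine tendsto_atTop_atTop_of_monotone (hmono ω) fun b => ?_
      obtain ⟨N, hN⟩ := exists_nat_ge b
      obtain ⟨n, hn⟩ := h2 N
      exact ⟨n, hN.trans hn⟩
  refine MeasurableEmbedding.iff_comap_eq.2 ⟨?_, ?_, ?_⟩
  · intro τ τ' h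
    exact Subtype.ext (funext fun n => Subtype.ext (congrFun h n))
  · simp only [MeasurableSpace.pi, Subtype.instMeasurableSpace, MeasurableSpace.comap_iSup,
      MeasurableSpace.comap_comp]
    rfl
  · rw [hrange]
    exact (MeasurableSet.iInter fun n => measurable_pi_apply n measurableSet_isGenState).inter
      (MeasurableSet.iInter fun N => MeasurableSet.iUnion fun n =>
        measurableSet_le measurable_const (hmeas n))

/-- The law of the trace started at the generalized state `g`: the law of the sequence of
configurations, restricted to the finitely varying sequences of generalized states. This is a
probability measure as soon as, from `g`, the process almost surely visits only generalized states
(no ties between clocks, and at least one active event) and is almost surely not Zeno. -/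
def traceLaw (g : M.GenState) : Measure M.Trace := (M.seqLaw g.1).comap M.traceVal

/-- `J(m)` on traces. -/
def traceJ (m : PMetric M.GenState) (τ τ' : M.Trace) : ℝ := skorohodJ m (M.path τ) (M.path τ')

/-- The functional `F_k`: `k` times the Wasserstein distance, over `J(m)`, of the laws of the
traces started at `g` and at `g'`. -/
def F (k : ℝ) (m : PMetric M.GenState) (g g' : M.GenState) : ℝ :=
  k * wasserstein (M.traceJ m) (M.traceLaw g) (M.traceLaw g')

end GSMP

end

/-! Fix a test function `h` that is 1-Lipschitz for J(m) and whose integral difference beats δ/k.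
The task is to find finitely many m-distances that force a slightly modified `h` to be 1-Lipschitz
for J(m'), whatever m' ⪰ m is.

Pointwise, a strict bound J(m)(ω,ω') > c only involves one point on one graph and, since J ≤ 1, a
bounded stretch of the other. That stretch is totally bounded because paths are cadlag, so a finite
net suffices. As m' ≤ m, closeness in m is closeness in m', and the bound persists for all pairs of
paths in suitable tubes around ω and ω' (`exists_tube_forall_lt_excess`). Tubes constrain rational
times only, so they are Borel, and there are countably many of them.

Traces form a standard Borel space, so there is a Polish topology with the same Borel sets in which
all tubes are open and `h` is continuous (`exists_polishSpace_isOpen_continuous`). In it every J(m')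
with m' ⪰ m is lower semicontinuous, although m' is not assumed Borel. Up to small mass, both laws
live on a compact K; compactness of K × K yields one finite set and one ε for which `h` is
J(m')-Lipschitz on K up to an error η (`exists_finset_forall_sub_lt_skorohodJ`). The McShane-type
extension min(1, inf over y in K of h(y) + J(m')(x,y)) is then exactly Lipschitz everywhere, lies
between h − η and h on K, and is Borel because K is compact and J(m') lower semicontinuous. -/

noncomputable section

/-! ### Graph metric and cadlag functions -/

namespace PMetric

variable {X : Type*}

/-- The maximum metric on `[0,∞) × X`. -/
def graphDist (m : PMetric X) (z w : ℝ≥0 × X) : ℝ := max (m.d z.2 w.2) (dist z.1 w.1)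

lemma graphDist_nonneg (m : PMetric X) (z w : ℝ≥0 × X) : 0 ≤ m.graphDist z w :=
  (m.nonneg _ _).trans (le_max_left _ _)

lemma graphDist_symm (m : PMetric X) (z w : ℝ≥0 × X) : m.graphDist z w = m.graphDist w z := by
  rw [graphDist, graphDist, m.symm, dist_comm]

lemma graphDist_triangle (m : PMetric X) (x y z : ℝ≥0 × X) :
    m.graphDist x z ≤ m.graphDist x y + m.graphDist y z :=
  max_le ((m.triangle _ y.2 _).trans (add_le_add (le_max_left _ _) (le_max_left _ _)))
    ((dist_triangle _ y.1 _).trans (add_le_add (le_max_right _ _) (le_max_right _ _)))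

lemma Preceq.graphDist_le {m m' : PMetric X} (h : m.Preceq m') (z w : ℝ≥0 × X) :
    m'.graphDist z w ≤ m.graphDist z w :=
  max_le_max (h _ _) le_rfl

lemma graphDist_le_one_of_fst_eq (m : PMetric X) (t : ℝ≥0) (x y : X) :
    m.graphDist (t, x) (t, y) ≤ 1 := by
  simp [graphDist, m.le_one]

/-- Second countability passes to [0,∞) × X, which is therefore separable. The dense sequence
supplies the countable stock of tube centres. -/
lemma exists_seq_graphDist_lt [Nonempty X] {m : PMetric X} (hm : m.HasCountableBasis) :
    ∃ D : ℕ → ℝ≥0 × X, ∀ z, ∀ ε > 0, ∃ l, m.graphDist (D l) z < ε := by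
  let := m.toPseudoMetricSpace
  have : SecondCountableTopology X := hm
  refine ⟨TopologicalSpace.denseSeq _, fun z ε hε => ?_⟩
  obtain ⟨l, hl⟩ := (TopologicalSpace.denseRange_denseSeq (ℝ≥0 × X)).exists_dist_lt z hε
  refine ⟨l, ?_⟩
  rw [dist_comm, Prod.dist_eq, max_comm] at hl
  exact hl

lemma IsCadlag.eventually_right {m : PMetric X} {f : ℝ≥0 → X} (hf : m.IsCadlag f) (t : ℝ≥0)
    {ε : ℝ} (hε : 0 < ε) : ∀ᶠ s in 𝓝[>] t, m.d (f s) (f t) < ε := by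
  let := m.toPseudoMetricSpace
  exact Metric.tendsto_nhds.1 (hf t).1 ε hε

lemma IsCadlag.eventually_left {m : PMetric X} {f : ℝ≥0 → X} (hf : m.IsCadlag f) (t : ℝ≥0)
    {ε : ℝ} (hε : 0 < ε) : ∃ x, ∀ᶠ s in 𝓝[<] t, m.d (f s) x < ε := by
  let := m.toPseudoMetricSpace
  obtain ⟨x, hx⟩ := (hf t).2
  exact ⟨x, Metric.tendsto_nhds.1 hx ε hε⟩

/-- A cadlag function is approximated from the right, in graph distance, at rational times. -/
lemma IsCadlag.exists_nnrat_graphDist_lt {m : PMetric X} {f : ℝ≥0 → X} (hf : m.IsCadlag f)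
    {t b : ℝ≥0} (hb : t < b) {ε : ℝ} (hε : 0 < ε) :
    ∃ q : ℚ≥0, t < q ∧ q < b ∧ m.graphDist ((q : ℝ≥0), f q) (t, f t) < ε := by
  have h1 : ∀ᶠ s in 𝓝[>] t, dist s t < ε :=
    nhdsWithin_le_nhds (Metric.ball_mem_nhds t hε)
  have h2 : ∀ᶠ s in 𝓝[>] t, s < b := nhdsWithin_le_nhds (Iio_mem_nhds hb)
  obtain ⟨u, hu, hsub⟩ := (mem_nhdsGT_iff_exists_Ioo_subset).1
    ((h1.and h2).and (hf.eventually_right t hε))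
  obtain ⟨q, hq0, hq1, hq2⟩ := (NNReal.lt_iff_exists_rat_btwn _ _).1 (show t < u from hu)
  lift q to ℚ≥0 using hq0
  have hq : Real.toNNReal ((q : ℚ) : ℝ) = (q : ℝ≥0) := by
    apply NNReal.eq
    rw [Real.coe_toNNReal _ (by positivity)]
    simp
    rfl
  obtain ⟨⟨h1, h2⟩, h3⟩ := hsub ⟨hq1, hq2⟩
  rw [hq] at h1 h2 h3 hq1
  exact ⟨q, hq1, h2, max_lt h3 h1⟩

/-- On a bounded interval the graph of a cadlag function is totally bounded. -/
lemma IsCadlag.exists_finset_graphDist_lt {m : PMetric X} {f : ℝ≥0 → X} (hf : m.IsCadlag f)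
    {D : ℕ → ℝ≥0 × X} (hD : ∀ z, ∀ ε > 0, ∃ l, m.graphDist (D l) z < ε) (N : ℝ≥0)
    {ε : ℝ} (hε : 0 < ε) :
    ∃ L : Finset ℕ, (∀ l ∈ L, ∃ t, m.graphDist (D l) (t, f t) < ε) ∧
      ∀ s ≤ N, ∃ l ∈ L, m.graphDist (D l) (s, f s) < ε := by
  classical
  suffices h : ∃ L : Finset ℕ, (∀ l ∈ L, ∃ t, m.graphDist (D l) (t, f t) < ε) ∧
      ∀ s ∈ Icc 0 N, ∃ l ∈ L, m.graphDist (D l) (s, f s) < ε by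
    obtain ⟨L, h1, h2⟩ := h
    exact ⟨L, h1, fun s hs => h2 s ⟨zero_le, hs⟩⟩
  refine (isCompact_Icc (a := (0 : ℝ≥0)) (b := N)).induction_on (p := fun A =>
    ∃ L : Finset ℕ, (∀ l ∈ L, ∃ t, m.graphDist (D l) (t, f t) < ε) ∧
      ∀ s ∈ A, ∃ l ∈ L, m.graphDist (D l) (s, f s) < ε) ⟨∅, by simp, by simp⟩ ?_ ?_ ?_
  · rintro A B hAB ⟨L, h1, h2⟩
    exact ⟨L, h1, fun s hs => h2 s (hAB hs)⟩
  · rintro A B ⟨L, h1, h2⟩ ⟨L', h1', h2'⟩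
    refine ⟨L ∪ L', fun l hl => (Finset.mem_union.1 hl).elim (h1 l) (h1' l), ?_⟩
    rintro s (hs | hs)
    · obtain ⟨l, hl, h⟩ := h2 s hs
      exact ⟨l, Finset.mem_union_left _ hl, h⟩
    · obtain ⟨l, hl, h⟩ := h2' s hs
      exact ⟨l, Finset.mem_union_right _ hl, h⟩
  · intro u _
    have hε4 : 0 < ε / 4 := by positivity
    obtain ⟨x, hx⟩ := hf.eventually_left u hε4
    have hx := eventually_nhdsWithin_iff.1 hx
    have hr := eventually_nhdsWithin_iff.1 (hf.eventually_right u hε4)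
    have hd : ∀ᶠ s in 𝓝 u, dist s u < ε / 4 := Metric.ball_mem_nhds u hε4
    refine ⟨_, nhdsWithin_le_nhds ((hx.and hr).and hd), ?_⟩
    obtain ⟨l₁, hl₁⟩ := hD (u, f u) (ε / 4) hε4
    -- To the right of `u` the graph stays near (u, f u); to the left it stays near the left limit,
    -- which need not be a value of `f`, so a genuine graph point at some s₀ < u replaces it.
    have near_right : ∀ s, u ≤ s → (u < s → m.d (f s) (f u) < ε / 4) → dist s u < ε / 4 →
        m.graphDist (D l₁) (s, f s) < ε := by
      intro s hus h1 h2
      have h3 : m.d (f u) (f s) < ε / 4 := by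
        rcases hus.eq_or_lt with rfl | h
        · rwa [m.self]
        · rw [m.symm]; exact h1 h
      have h4 : m.graphDist (u, f u) (s, f s) < ε / 4 := max_lt h3 (by rwa [dist_comm])
      linarith [m.graphDist_triangle (D l₁) (u, f u) (s, f s)]
    by_cases hex : ∃ s₀ < u, m.d (f s₀) x < ε / 4 ∧ dist s₀ u < ε / 4
    · obtain ⟨s₀, -, hs₀, hs₀u⟩ := hex
      obtain ⟨l₂, hl₂⟩ := hD (s₀, f s₀) (ε / 4) hε4
      refine ⟨{l₁, l₂}, ?_, ?_⟩
      · intro l hl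
        rcases Finset.mem_insert.1 hl with rfl | hl
        · exact ⟨u, by linarith⟩
        · rw [Finset.mem_singleton.1 hl]
          exact ⟨s₀, by linarith⟩
      · rintro s ⟨⟨h1, h2⟩, h3⟩
        rcases lt_or_ge s u with hs | hs
        · refine ⟨l₂, by simp, ?_⟩
          have h4 : m.d (f s₀) (f s) < ε / 2 := by
            have := m.triangle (f s₀) x (f s)
            rw [m.symm x] at this
            linarith [h1 hs]
          have h5 : dist s₀ s < ε / 2 := by
            have := dist_triangle_right s₀ s u
            linarith
          have h6 : m.graphDist (s₀, f s₀) (s, f s) < ε / 2 := max_lt h4 h5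
          linarith [m.graphDist_triangle (D l₂) (s₀, f s₀) (s, f s)]
        · exact ⟨l₁, by simp, near_right s hs h2 h3⟩
    -- No time to the left of `u` is relevant (in effect u = 0), so one centre is enough.
    · push Not at hex
      refine ⟨{l₁}, fun l hl => ⟨u, ?_⟩, ?_⟩
      · rw [Finset.mem_singleton.1 hl]
        linarith
      · rintro s ⟨⟨h1, h2⟩, h3⟩
        rcases lt_or_ge s u with hs | hs
        · exact absurd h3 (hex s hs (h1 hs)).not_gt
        · exact ⟨l₁, by simp, near_right s hs h2 h3⟩

/-! ### One-sided Hausdorff excess and the Skorohod distance -/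

/-- How far the graph of `f` sticks out of the graph of `g`. -/
def excess (m : PMetric X) (f g : ℝ≥0 → X) : ℝ :=
  ⨆ t : ℝ≥0, ⨅ t' : ℝ≥0, m.graphDist (t, f t) (t', g t')

lemma bddBelow_graphDist (m : PMetric X) (z : ℝ≥0 × X) (g : ℝ≥0 → X) :
    BddBelow (range fun t' : ℝ≥0 => m.graphDist z (t', g t')) :=
  ⟨0, by rintro _ ⟨t', rfl⟩; exact m.graphDist_nonneg _ _⟩

/-- The choice t' = t leaves only an m-distance. Besides making the real supremum in `excess`
meaningful, this bound renders points far away in time irrelevant. -/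
lemma iInf_graphDist_le_one (m : PMetric X) (f g : ℝ≥0 → X) (t : ℝ≥0) :
    ⨅ t' : ℝ≥0, m.graphDist (t, f t) (t', g t') ≤ 1 :=
  (ciInf_le (m.bddBelow_graphDist _ g) t).trans (m.graphDist_le_one_of_fst_eq _ _ _)

lemma bddAbove_iInf_graphDist (m : PMetric X) (f g : ℝ≥0 → X) :
    BddAbove (range fun t : ℝ≥0 => ⨅ t' : ℝ≥0, m.graphDist (t, f t) (t', g t')) :=
  ⟨1, by rintro _ ⟨t, rfl⟩; exact m.iInf_graphDist_le_one f g t⟩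

lemma le_excess (m : PMetric X) {f g : ℝ≥0 → X} {r : ℝ} (t : ℝ≥0)
    (h : ∀ t', r ≤ m.graphDist (t, f t) (t', g t')) : r ≤ m.excess f g :=
  (le_ciInf h).trans (le_ciSup (m.bddAbove_iInf_graphDist f g) t)

lemma excess_nonneg (m : PMetric X) (f g : ℝ≥0 → X) : 0 ≤ m.excess f g :=
  m.le_excess 0 fun _ => m.graphDist_nonneg _ _

lemma exists_of_lt_excess (m : PMetric X) {f g : ℝ≥0 → X} {c : ℝ} (h : c < m.excess f g) :
    ∃ t r, c < r ∧ r ≤ 1 ∧ ∀ t', r ≤ m.graphDist (t, f t) (t', g t') := by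
  obtain ⟨t, ht⟩ := exists_lt_of_lt_ciSup h
  exact ⟨t, _, ht, m.iInf_graphDist_le_one f g t, ciInf_le (m.bddBelow_graphDist _ g)⟩

lemma excess_triangle (m : PMetric X) (f g h : ℝ≥0 → X) :
    m.excess f h ≤ m.excess f g + m.excess g h := by
  refine ciSup_le fun t => le_of_forall_pos_le_add fun ε hε => ?_
  have h1 : ⨅ t' : ℝ≥0, m.graphDist (t, f t) (t', g t') < m.excess f g + ε / 2 :=
    (le_ciSup (m.bddAbove_iInf_graphDist f g) t).trans_lt (by rw [excess]; linarith)
  obtain ⟨u, hu⟩ := exists_lt_of_ciInf_lt h1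
  have h2 : ⨅ t' : ℝ≥0, m.graphDist (u, g u) (t', h t') < m.excess g h + ε / 2 :=
    (le_ciSup (m.bddAbove_iInf_graphDist g h) u).trans_lt (by rw [excess]; linarith)
  obtain ⟨v, hv⟩ := exists_lt_of_ciInf_lt h2
  have h3 := ciInf_le (m.bddBelow_graphDist (t, f t) h) v
  linarith [m.graphDist_triangle (t, f t) (u, g u) (v, h v)]

lemma excess_self (m : PMetric X) (f : ℝ≥0 → X) : m.excess f f = 0 := by
  refine le_antisymm (ciSup_le fun t => ?_) (m.excess_nonneg f f)
  refine (ciInf_le (m.bddBelow_graphDist _ f) t).trans ?_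
  simp [graphDist, m.self]

lemma skorohodJ_eq (m : PMetric X) (f g : ℝ≥0 → X) :
    skorohodJ m f g = max (m.excess f g) (m.excess g f) := by
  unfold skorohodJ excess graphDist
  congr 1
  refine iSup_congr fun t => iInf_congr fun t' => ?_
  rw [m.symm, dist_comm]

lemma skorohodJ_nonneg (m : PMetric X) (f g : ℝ≥0 → X) : 0 ≤ skorohodJ m f g := by
  rw [skorohodJ_eq]
  exact (m.excess_nonneg f g).trans (le_max_left _ _)

lemma skorohodJ_self (m : PMetric X) (f : ℝ≥0 → X) : skorohodJ m f f = 0 := by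
  rw [skorohodJ_eq, excess_self, max_self]

lemma skorohodJ_symm (m : PMetric X) (f g : ℝ≥0 → X) : skorohodJ m f g = skorohodJ m g f := by
  rw [skorohodJ_eq, skorohodJ_eq, max_comm]

lemma skorohodJ_triangle (m : PMetric X) (f g h : ℝ≥0 → X) :
    skorohodJ m f h ≤ skorohodJ m f g + skorohodJ m g h := by
  simp only [skorohodJ_eq]
  refine max_le ((m.excess_triangle f g h).trans
    (add_le_add (le_max_left _ _) (le_max_left _ _))) ?_
  rw [add_comm]
  exact (m.excess_triangle h g f).trans (add_le_add (le_max_right _ _) (le_max_right _ _))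

/-! ### Tubes and lower semicontinuity of the Skorohod distance -/

/-- The indices of the tubes: a rational time interval, a finite set of centres, a radius. -/
abbrev TubeIndex : Type := ℚ≥0 × ℚ≥0 × Finset ℕ × ℕ

/-- The elements whose path stays, at the rational times of an interval, in a finite union of
balls in `[0,∞) × X`. -/
def tube {Ω : Type*} (m : PMetric X) (D : ℕ → ℝ≥0 × X) (p : Ω → ℝ≥0 → X) (i : TubeIndex) :
    Set Ω :=
  {w | ∀ q : ℚ≥0, i.1 ≤ q → q ≤ i.2.1 →
    ∃ l ∈ i.2.2.1, m.graphDist (D l) ((q : ℝ≥0), p w q) < 1 / ((i.2.2.2 : ℝ) + 1)}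

lemma measurableSet_tube {Ω : Type*} [MeasurableSpace Ω] (m : PMetric X) (D : ℕ → ℝ≥0 × X)
    {p : Ω → ℝ≥0 → X} (hp : ∀ a t, Measurable fun w => m.d a (p w t)) (i : TubeIndex) :
    MeasurableSet (m.tube D p i) := by
  have : m.tube D p i = ⋂ q : ℚ≥0, ⋂ _ : i.1 ≤ q, ⋂ _ : q ≤ i.2.1, ⋃ l ∈ i.2.2.1,
      {w | m.graphDist (D l) ((q : ℝ≥0), p w q) < 1 / ((i.2.2.2 : ℝ) + 1)} := by
    ext w
    simp [tube]
  rw [this]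
  refine MeasurableSet.iInter fun q => MeasurableSet.iInter fun _ => MeasurableSet.iInter fun _ =>
    Finset.measurableSet_biUnion _ fun l _ => ?_
  exact measurableSet_lt ((hp _ _).max (measurable_const (a := dist (D l).1 (q : ℝ≥0)))) measurable_const

/-- Right continuity transfers the rational-time condition to every real time at the cost of
doubling the radius. The end `b` is excluded because the approximating rational lies strictly to the
right of `s`. -/
lemma exists_graphDist_lt_of_mem_tube {Ω : Type*} {m : PMetric X} {D : ℕ → ℝ≥0 × X}
    {p : Ω → ℝ≥0 → X} {w : Ω} (hw : m.IsCadlag (p w)) {a b : ℚ≥0} {L : Finset ℕ} {n : ℕ}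
    (h : w ∈ m.tube D p (a, b, L, n)) {s : ℝ≥0} (has : a ≤ s) (hsb : s < b) :
    ∃ l ∈ L, m.graphDist (D l) (s, p w s) < 2 / ((n : ℝ) + 1) := by
  have hn : 0 < 1 / ((n : ℝ) + 1) := by positivity
  obtain ⟨q, hsq, hqb, hq⟩ := hw.exists_nnrat_graphDist_lt hsb hn
  obtain ⟨l, hl, hlq⟩ := h q (by exact_mod_cast has.trans hsq.le) (by exact_mod_cast hqb.le)
  refine ⟨l, hl, ?_⟩
  have h2 : 2 / ((n : ℝ) + 1) = 1 / ((n : ℝ) + 1) + 1 / ((n : ℝ) + 1) := by ring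
  have := m.graphDist_triangle (D l) ((q : ℝ≥0), p w q) (s, p w s)
  rw [h2]
  linarith

/-- A strict lower bound on the excess is detected by finitely many distances, uniformly over
tubes around the two paths. -/
lemma exists_tube_forall_lt_excess {Ω : Type*} {m m₁ : PMetric X} (hm₁ : m.Preceq m₁)
    {D : ℕ → ℝ≥0 × X} (hD : ∀ z, ∀ ε > 0, ∃ l, m.graphDist (D l) z < ε) {p : Ω → ℝ≥0 → X}
    (hp : ∀ w, m.IsCadlag (p w)) {w w' : Ω} {c : ℝ} (hc : c < m₁.excess (p w) (p w')) :
    ∃ i j, w ∈ m.tube D p i ∧ w' ∈ m.tube D p j ∧ ∃ (G : Finset X) (ε : ℝ), 0 < ε ∧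
      ∀ m' : PMetric X, m.Preceq m' → (∀ a ∈ G, ∀ b ∈ G, m₁.d a b - ε ≤ m'.d a b) →
        ∀ x ∈ m.tube D p i, ∀ y ∈ m.tube D p j, c < m'.excess (p x) (p y) := by
  classical
  obtain ⟨t₀, r, hcr, hr1, hr⟩ := m₁.exists_of_lt_excess hc
  -- With e = 1/(n+1), the comparison below loses 7e: e from t₀ to q, e from the net to the path of
  -- w', e from the finite test, and 2e for each of the two tubes. The margin of 12e leaves room.
  obtain ⟨n, hn⟩ := exists_nat_one_div_lt (show 0 < (r - c) / 12 by linarith)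
  have he : 0 < 1 / ((n : ℝ) + 1) := by positivity
  have h2e : 2 / ((n : ℝ) + 1) = 1 / ((n : ℝ) + 1) + 1 / ((n : ℝ) + 1) := by ring
  obtain ⟨q, hq0, -, hq⟩ := (hp w).exists_nnrat_graphDist_lt
    (show t₀ < t₀ + 1 from lt_add_one t₀) he
  obtain ⟨l₀, hl₀⟩ := hD ((q : ℝ≥0), p w q) _ he
  -- Beyond time q + 2 the time difference alone exceeds r ≤ 1, so a net up to q + 2 is enough.
  obtain ⟨L, hL1, hL2⟩ := (hp w').exists_finset_graphDist_lt hD ((q + 2 : ℚ≥0) : ℝ≥0) he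
  refine ⟨(q, q, {l₀}, n), (0, q + 2, L, n), ?_, ?_,
    insert (p w q) (L.image fun l => (D l).2), 1 / ((n : ℝ) + 1), he, ?_⟩
  · intro q' h1 h2
    obtain rfl : q' = q := le_antisymm h2 h1
    exact ⟨l₀, by simp, hl₀⟩
  · intro q' _ h2
    exact hL2 q' (by exact_mod_cast h2)
  · intro m' hm' hG x hx y hy
    obtain ⟨l, hl, hxl⟩ := hx q le_rfl le_rfl
    rw [Finset.mem_singleton.1 hl] at hxl
    have hxq : m'.graphDist ((q : ℝ≥0), p w q) ((q : ℝ≥0), p x q) < 2 / ((n : ℝ) + 1) := by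
      refine (hm'.graphDist_le _ _).trans_lt ?_
      rw [m.graphDist_symm] at hl₀
      linarith [m.graphDist_triangle ((q : ℝ≥0), p w q) (D l₀) ((q : ℝ≥0), p x q)]
    refine lt_of_lt_of_le (show c < r - 8 * (1 / ((n : ℝ) + 1)) by linarith)
      (m'.le_excess (q : ℝ≥0) fun s => ?_)
    rcases lt_or_ge s ((q + 2 : ℚ≥0) : ℝ≥0) with hs | hs
    · obtain ⟨l, hl, hyl⟩ := exists_graphDist_lt_of_mem_tube (hp y) hy
        (by simp : ((0 : ℚ≥0) : ℝ≥0) ≤ s) hs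
      obtain ⟨t', ht'⟩ := hL1 l hl
      have h1 := (hm'.graphDist_le _ _).trans_lt hyl
      have h2 := (hm₁.graphDist_le _ _).trans_lt ht'
      have h3 := (hm₁.graphDist_le _ _).trans_lt hq
      rw [m₁.graphDist_symm] at h3
      have h4 : m₁.graphDist ((q : ℝ≥0), p w q) (D l) - 1 / ((n : ℝ) + 1) ≤
          m'.graphDist ((q : ℝ≥0), p w q) (D l) := by
        rw [sub_le_iff_le_add]
        refine max_le ?_ ((le_max_right _ _).trans (le_add_of_nonneg_right he.le))
        have := hG (p w q) (Finset.mem_insert_self _ _) (D l).2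
          (Finset.mem_insert_of_mem (Finset.mem_image_of_mem _ hl))
        refine (sub_le_iff_le_add.1 this).trans ?_
        gcongr
        exact le_max_left _ _
      have h5 := m₁.graphDist_triangle (t₀, p w t₀) ((q : ℝ≥0), p w q) (t', p w' t')
      have h6 := m₁.graphDist_triangle ((q : ℝ≥0), p w q) (D l) (t', p w' t')
      have h7 := m'.graphDist_triangle ((q : ℝ≥0), p w q) ((q : ℝ≥0), p x q) (D l)
      have h8 := m'.graphDist_triangle ((q : ℝ≥0), p x q) (s, p y s) (D l)
      rw [m'.graphDist_symm (s, p y s)] at h8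
      linarith [hr t']
    · refine le_trans ?_ (le_max_right _ _)
      have h1 : ((q : ℝ≥0) : ℝ) + 2 ≤ s := by
        have : (q : ℝ≥0) + 2 ≤ s := by simpa using hs
        exact_mod_cast this
      have h2 : (s : ℝ) - (q : ℝ≥0) ≤ dist (q : ℝ≥0) s := by
        rw [NNReal.dist_eq, abs_sub_comm]
        exact le_abs_self _
      simp only
      linarith

/-- A strict lower bound on the Skorohod distance of two paths is detected by finitely many
distances, uniformly over neighbourhoods for any topology in which the tubes are open. -/
lemma exists_open_forall_lt_skorohodJ {Ω : Type*} [TopologicalSpace Ω] {m m₁ : PMetric X}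
    (hm₁ : m.Preceq m₁) {D : ℕ → ℝ≥0 × X} (hD : ∀ z, ∀ ε > 0, ∃ l, m.graphDist (D l) z < ε)
    {p : Ω → ℝ≥0 → X} (hp : ∀ w, m.IsCadlag (p w)) (ho : ∀ i, IsOpen (m.tube D p i))
    {w w' : Ω} {c : ℝ} (hc : c < skorohodJ m₁ (p w) (p w')) :
    ∃ U V : Set Ω, IsOpen U ∧ IsOpen V ∧ w ∈ U ∧ w' ∈ V ∧ ∃ (G : Finset X) (ε : ℝ), 0 < ε ∧
      ∀ m' : PMetric X, m.Preceq m' → (∀ a ∈ G, ∀ b ∈ G, m₁.d a b - ε ≤ m'.d a b) →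
        ∀ x ∈ U, ∀ y ∈ V, c < skorohodJ m' (p x) (p y) := by
  simp only [skorohodJ_eq, lt_max_iff] at hc ⊢
  rcases hc with hc | hc
  · obtain ⟨i, j, hi, hj, G, ε, hε, h⟩ := exists_tube_forall_lt_excess hm₁ hD hp hc
    exact ⟨_, _, ho i, ho j, hi, hj, G, ε, hε,
      fun m' h1 h2 x hx y hy => Or.inl (h m' h1 h2 x hx y hy)⟩
  · obtain ⟨i, j, hi, hj, G, ε, hε, h⟩ := exists_tube_forall_lt_excess hm₁ hD hp hc
    exact ⟨_, _, ho j, ho i, hj, hi, G, ε, hε,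
      fun m' h1 h2 x hx y hy => Or.inr (h m' h1 h2 y hy x hx)⟩

/-- The Skorohod distance is lower semicontinuous for any topology in which the tubes are open. -/
lemma lowerSemicontinuous_skorohodJ {Ω : Type*} [TopologicalSpace Ω] {m m' : PMetric X}
    (hm' : m.Preceq m') {D : ℕ → ℝ≥0 × X} (hD : ∀ z, ∀ ε > 0, ∃ l, m.graphDist (D l) z < ε)
    {p : Ω → ℝ≥0 → X} (hp : ∀ w, m.IsCadlag (p w)) (ho : ∀ i, IsOpen (m.tube D p i)) :
    LowerSemicontinuous fun z : Ω × Ω => skorohodJ m' (p z.1) (p z.2) := by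
  rintro ⟨w, w'⟩ c hc
  -- With m₁ = m' the test on the finite set is vacuous for m' itself, while the tubes are still
  -- those of m.
  obtain ⟨U, V, hU, hV, hw, hw', G, ε, hε, h⟩ := exists_open_forall_lt_skorohodJ hm' hD hp ho hc
  filter_upwards [prod_mem_nhds (hU.mem_nhds hw) (hV.mem_nhds hw')] with z hz
  exact h m' hm' (fun a _ b _ => by linarith) _ hz.1 _ hz.2

end PMetric

/-! ### Refining the Polish topology -/

/-- A standard Borel space has a compatible Polish topology making countably many given measurable
sets open and a given measurable function continuous. -/
lemma exists_polishSpace_isOpen_continuous {Ω ι : Type*} [MeasurableSpace Ω]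
    [StandardBorelSpace Ω] [Countable ι] {A : ι → Set Ω} (hA : ∀ i, MeasurableSet (A i))
    {h : Ω → ℝ} (hh : Measurable h) :
    ∃ _ : TopologicalSpace Ω, BorelSpace Ω ∧ PolishSpace Ω ∧ (∀ i, IsOpen (A i)) ∧
      Continuous h := by
  classical
  obtain ⟨t, hb, hpol⟩ := StandardBorelSpace.polish (α := Ω)
  have hf : Measurable fun w => ((fun i => decide (w ∈ A i), h w) : (ι → Bool) × ℝ) := by
    refine (measurable_pi_lambda _ fun i => ?_).prodMk hh
    refine measurable_to_bool ?_
    convert! hA i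
    ext w
    simp
  obtain ⟨t', hle, hcont, hpol'⟩ := hf.exists_continuous
  refine ⟨t', ⟨?_⟩, hpol', fun i => ?_, continuous_snd.comp hcont⟩
  -- Comparable Polish topologies have the same Borel sets.
  · rw [hb.measurable_eq, borel_eq_borel_of_le hpol' hpol hle]
  · have h1 : Continuous fun w => decide (w ∈ A i) :=
      (continuous_apply i).comp (continuous_fst.comp hcont)
    have h2 : A i = (fun w => decide (w ∈ A i)) ⁻¹' {true} := by
      ext w
      simp
    rw [h2]
    exact (isOpen_discrete _).preimage h1

/-! ### Truncated infimal convolution -/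

section InfConv

variable {Ω : Type*}

/-- The truncated infimal convolution of `h`, restricted to `K`, with the distance `d`. -/
def infConv (K : Set Ω) (h : Ω → ℝ) (d : Ω → Ω → ℝ) (x : Ω) : ℝ :=
  min 1 (⨅ y : K, (h y + d x y))

variable {K : Set Ω} {h : Ω → ℝ} {d : Ω → Ω → ℝ}

lemma bddBelow_add_of_nonneg (hh : ∀ x, 0 ≤ h x) (hd : ∀ x y, 0 ≤ d x y) (x : Ω) :
    BddBelow (range fun y : K => h y + d x y) :=
  ⟨0, by rintro _ ⟨y, rfl⟩; exact add_nonneg (hh _) (hd _ _)⟩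

lemma infConv_nonneg (hh : ∀ x, 0 ≤ h x) (hd : ∀ x y, 0 ≤ d x y) (x : Ω) :
    0 ≤ infConv K h d x :=
  le_min zero_le_one (Real.iInf_nonneg fun _ => add_nonneg (hh _) (hd _ _))

lemma infConv_le_one (x : Ω) : infConv K h d x ≤ 1 := min_le_left _ _

/-- Each x ↦ h(y) + d(x,y) is 1-Lipschitz by the triangle inequality, and this survives infima and
truncation. For empty `K` the real infimum is 0 and the function is constant. -/
lemma infConv_le_add (hh : ∀ x, 0 ≤ h x) (hd : ∀ x y, 0 ≤ d x y)
    (htri : ∀ x y z, d x z ≤ d x y + d y z) (x x' : Ω) :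
    infConv K h d x ≤ infConv K h d x' + d x x' := by
  have key : (⨅ y : K, (h y + d x y)) ≤ (⨅ y : K, (h y + d x' y)) + d x x' := by
    rcases isEmpty_or_nonempty K with hK | hK
    · simpa [Real.iInf_of_isEmpty] using hd x x'
    · rw [← sub_le_iff_le_add]
      refine le_ciInf fun y => ?_
      have := ciInf_le (bddBelow_add_of_nonneg (K := K) hh hd x) y
      linarith [htri x x' y]
  unfold infConv
  rw [← min_add_add_right]
  exact le_min ((min_le_left _ _).trans (le_add_of_nonneg_right (hd _ _)))
    ((min_le_right _ _).trans key)

lemma abs_infConv_sub_le (hh : ∀ x, 0 ≤ h x) (hd : ∀ x y, 0 ≤ d x y)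
    (hsymm : ∀ x y, d x y = d y x) (htri : ∀ x y z, d x z ≤ d x y + d y z) (x x' : Ω) :
    |infConv K h d x - infConv K h d x'| ≤ d x x' := by
  have h1 := infConv_le_add (K := K) hh hd htri x x'
  have h2 := infConv_le_add (K := K) hh hd htri x' x
  rw [hsymm x' x] at h2
  exact abs_sub_le_iff.2 ⟨by linarith, by linarith⟩

lemma infConv_le (hh : ∀ x, 0 ≤ h x) (hd : ∀ x y, 0 ≤ d x y) (hself : ∀ x, d x x = 0)
    {x : Ω} (hx : x ∈ K) : infConv K h d x ≤ h x := by
  refine (min_le_right _ _).trans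
    ((ciInf_le (bddBelow_add_of_nonneg (K := K) hh hd x) ⟨x, hx⟩).trans ?_)
  simp [hself]

lemma le_infConv {x : Ω} (hx : x ∈ K) {r : ℝ} (hr1 : r ≤ 1) (hr : ∀ y ∈ K, r ≤ h y + d x y) :
    r ≤ infConv K h d x := by
  have : Nonempty K := ⟨⟨x, hx⟩⟩
  exact le_min hr1 (le_ciInf fun y => hr y y.2)

/-- The infimal convolution over a compact set with a lower semicontinuous distance is Borel. -/
lemma measurable_infConv [TopologicalSpace Ω] [MeasurableSpace Ω] [BorelSpace Ω]
    (hK : IsCompact K) (hc : Continuous h) (hh : ∀ x, 0 ≤ h x) (hd : ∀ x y, 0 ≤ d x y)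
    (hlsc : LowerSemicontinuous fun z : Ω × Ω => d z.1 z.2) : Measurable (infConv K h d) := by
  refine measurable_const.min ?_
  rcases isEmpty_or_nonempty K with hK' | hK'
  · simp only [Real.iInf_of_isEmpty]
    exact measurable_const
  have : CompactSpace K := isCompact_iff_compactSpace.1 hK
  have hl : LowerSemicontinuous fun z : Ω × K => h z.2 + d z.1 z.2 :=
    (hc.comp (continuous_subtype_val.comp continuous_snd)).lowerSemicontinuous.add
      (hlsc.comp (continuous_fst.prodMk (continuous_subtype_val.comp continuous_snd)))
  refine measurable_of_Iio fun c => ?_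
  -- Sublevel sets of the lower semicontinuous integrand are closed, and projecting along the
  -- compact `K` keeps them closed; the strict sublevel set of the infimum is thus an F_σ.
  have : (fun x => ⨅ y : K, (h y + d x y)) ⁻¹' Iio c =
      ⋃ n : ℕ, Prod.fst '' ((fun z : Ω × K => h z.2 + d z.1 z.2) ⁻¹' Iic (c - 1 / (n + 1))) := by
    ext x
    simp only [mem_preimage, mem_Iio, mem_iUnion, mem_image, mem_Iic, Prod.exists]
    constructor
    · intro hx
      obtain ⟨y, hy⟩ := exists_lt_of_ciInf_lt hx
      obtain ⟨n, hn⟩ := exists_nat_one_div_lt (sub_pos.2 hy)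
      exact ⟨n, x, y, by linarith, rfl⟩
    · rintro ⟨n, x, y, hxy, rfl⟩
      have : 0 < 1 / ((n : ℝ) + 1) := by positivity
      exact (ciInf_le (bddBelow_add_of_nonneg hh hd x) y).trans_lt (by linarith)
  rw [this]
  exact MeasurableSet.iUnion fun n =>
    (isClosedMap_fst_of_compactSpace _ (hl.isClosed_preimage _)).measurableSet

end InfConv

/-! ### Compactness argument and finite detectability for path measures -/

namespace PMetric

variable {X : Type*}

/-- On a compact set of paths, a Lipschitz function for the Skorohod distance is almost Lipschitz
for the Skorohod distance of every pseudometric that is close on a suitable finite set. -/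
lemma exists_finset_forall_sub_lt_skorohodJ {Ω : Type*} [TopologicalSpace Ω] {m : PMetric X}
    {D : ℕ → ℝ≥0 × X} (hD : ∀ z, ∀ ε > 0, ∃ l, m.graphDist (D l) z < ε) {p : Ω → ℝ≥0 → X}
    (hp : ∀ w, m.IsCadlag (p w)) (ho : ∀ i, IsOpen (m.tube D p i)) {h : Ω → ℝ}
    (hc : Continuous h) (hlip : ∀ x y, |h x - h y| ≤ skorohodJ m (p x) (p y)) {K : Set Ω}
    (hK : IsCompact K) {η : ℝ} (hη : 0 < η) :
    ∃ (G : Finset X) (ε : ℝ), 0 < ε ∧ ∀ m' : PMetric X, m.Preceq m' →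
      (∀ a ∈ G, ∀ b ∈ G, m.d a b - ε ≤ m'.d a b) →
        ∀ z ∈ K ×ˢ K, h z.1 - h z.2 - η < skorohodJ m' (p z.1) (p z.2) := by
  classical
  refine (hK.prod hK).induction_on (p := fun A => ∃ (G : Finset X) (ε : ℝ), 0 < ε ∧
    ∀ m' : PMetric X, m.Preceq m' → (∀ a ∈ G, ∀ b ∈ G, m.d a b - ε ≤ m'.d a b) →
      ∀ z ∈ A, h z.1 - h z.2 - η < skorohodJ m' (p z.1) (p z.2)) ⟨∅, 1, one_pos, by simp⟩ ?_ ?_ ?_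
  · rintro A B hAB ⟨G, ε, hε, H⟩
    exact ⟨G, ε, hε, fun m' h1 h2 z hz => H m' h1 h2 z (hAB hz)⟩
  · rintro A B ⟨G, ε, hε, H⟩ ⟨G', ε', hε', H'⟩
    refine ⟨G ∪ G', min ε ε', lt_min hε hε', fun m' h1 h2 z hz => ?_⟩
    rcases hz with hz | hz
    · refine H m' h1 (fun a ha b hb => ?_) z hz
      have := h2 a (Finset.mem_union_left _ ha) b (Finset.mem_union_left _ hb)
      linarith [min_le_left ε ε']
    · refine H' m' h1 (fun a ha b hb => ?_) z hz
      have := h2 a (Finset.mem_union_right _ ha) b (Finset.mem_union_right _ hb)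
      linarith [min_le_right ε ε']
  · rintro ⟨w, w'⟩ -
    -- Half of η makes the pointwise inequality strict; the other half absorbs the oscillation of
    -- `h` near (w, w').
    have h1 : h w - h w' - η / 2 < skorohodJ m (p w) (p w') := by
      linarith [(le_abs_self _).trans (hlip w w')]
    obtain ⟨U, V, hU, hV, hw, hw', G, ε, hε, H⟩ :=
      exists_open_forall_lt_skorohodJ (fun _ _ => le_rfl) hD hp ho h1
    have h2 : {z : Ω × Ω | h z.1 - h z.2 < h w - h w' + η / 2} ∈ 𝓝 (w, w') :=
      ((by fun_prop : Continuous fun z : Ω × Ω => h z.1 - h z.2).isOpen_preimage _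
        isOpen_Iio).mem_nhds (show h w - h w' < h w - h w' + η / 2 by linarith)
    refine ⟨_, nhdsWithin_le_nhds (inter_mem (prod_mem_nhds (hU.mem_nhds hw) (hV.mem_nhds hw')) h2),
      G, ε, hε, fun m' h1 h2 z hz => ?_⟩
    have h3 := H m' h1 h2 _ hz.1.1 _ hz.1.2
    have h4 : h z.1 - h z.2 < h w - h w' + η / 2 := hz.2
    linarith

/-- Finite detectability of a lower bound on the Wasserstein distance of two finite measures on a
space of cadlag paths with the Skorohod distance. -/
theorem exists_finset_forall_exists_lt_integral_sub {Ω : Type*} [MeasurableSpace Ω]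
    [StandardBorelSpace Ω] [Nonempty X] (P Q : Measure Ω) [IsFiniteMeasure P] [IsFiniteMeasure Q]
    {m : PMetric X} (hm : m.HasCountableBasis) {p : Ω → ℝ≥0 → X}
    (hp : ∀ w, m.IsCadlag (p w)) (hpm : ∀ a t, Measurable fun w => m.d a (p w t)) {h : Ω → ℝ}
    (hh : Measurable h) (h01 : ∀ x, 0 ≤ h x ∧ h x ≤ 1)
    (hlip : ∀ x y, |h x - h y| ≤ skorohodJ m (p x) (p y)) {c : ℝ}
    (hc : c < ∫ x, h x ∂P - ∫ x, h x ∂Q) :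
    ∃ (G : Finset X) (ε : ℝ), 0 < ε ∧ ∀ m' : PMetric X, m.Preceq m' →
      (∀ a ∈ G, ∀ b ∈ G, m.d a b - ε ≤ m'.d a b) →
        ∃ h' : Ω → ℝ, Measurable h' ∧ (∀ x, 0 ≤ h' x ∧ h' x ≤ 1) ∧
          (∀ x y, |h' x - h' y| ≤ skorohodJ m' (p x) (p y)) ∧
            c < ∫ x, h' x ∂P - ∫ x, h' x ∂Q := by
  obtain ⟨D, hD⟩ := exists_seq_graphDist_lt hm
  obtain ⟨_, _, _, ho, hcont⟩ :=
    exists_polishSpace_isOpen_continuous (fun i => m.measurableSet_tube D hpm i) hh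
  -- The budget: η pointwise under P, plus at most η for the mass that each of P and Q puts outside
  -- `K`.
  obtain ⟨η, hη, hηlt⟩ : ∃ η > 0, η * P.real univ + η + η < ∫ x, h x ∂P - ∫ x, h x ∂Q - c := by
    have hP : 0 ≤ P.real univ := measureReal_nonneg
    refine ⟨(∫ x, h x ∂P - ∫ x, h x ∂Q - c) / (P.real univ + 3),
      div_pos (by linarith) (by linarith), ?_⟩
    have : 0 < P.real univ + 3 := by linarith
    rw [show ∀ a : ℝ, a * P.real univ + a + a = a * (P.real univ + 2) by intro a; ring,
      div_mul_eq_mul_div, div_lt_iff₀ this]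
    exact mul_lt_mul_of_pos_left (by linarith) (by linarith)
  -- Tightness in the refined Polish topology; using P + Q gives one compact set for both measures.
  obtain ⟨K, -, hK, hKμ⟩ := (MeasurableSet.univ (α := Ω)).exists_isCompact_sdiff_lt
    (μ := P + Q) (measure_ne_top _ _) (ENNReal.ofReal_pos.2 hη).ne'
  rw [← compl_eq_univ_sdiff, Measure.add_apply] at hKμ
  have hKm : MeasurableSet Kᶜ := hK.measurableSet.compl
  have hPK : P.real Kᶜ ≤ η := ENNReal.toReal_le_of_le_ofReal hη.le (le_self_add.trans hKμ.le)
  have hQK : Q.real Kᶜ ≤ η := ENNReal.toReal_le_of_le_ofReal hη.le (le_add_self.trans hKμ.le)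
  obtain ⟨G, ε, hε, H⟩ := exists_finset_forall_sub_lt_skorohodJ hD hp ho hcont hlip hK hη
  refine ⟨G, ε, hε, fun m' h1 h2 => ?_⟩
  set d : Ω → Ω → ℝ := fun x y => skorohodJ m' (p x) (p y) with hd
  have hd0 : ∀ x y, 0 ≤ d x y := fun x y => m'.skorohodJ_nonneg _ _
  have hh0 : ∀ x, 0 ≤ h x := fun x => (h01 x).1
  have hmeas : Measurable (infConv K h d) := measurable_infConv hK hcont hh0 hd0
    (lowerSemicontinuous_skorohodJ h1 hD hp ho)
  have hint : ∀ (μ : Measure Ω) [IsFiniteMeasure μ] {f : Ω → ℝ}, Measurable f →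
      (∀ x, 0 ≤ f x) → (∀ x, f x ≤ 1) → Integrable f μ := fun μ _ f hf h0 h1 =>
    Integrable.of_bound hf.aestronglyMeasurable 1
      (ae_of_all _ fun x => by rw [Real.norm_of_nonneg (h0 x)]; exact h1 x)
  have h'0 : ∀ x, 0 ≤ infConv K h d x := infConv_nonneg hh0 hd0
  have h'1 : ∀ x, infConv K h d x ≤ 1 := infConv_le_one
  have hind : ∀ (μ : Measure Ω) [IsFiniteMeasure μ],
      Integrable (Kᶜ.indicator fun _ => (1 : ℝ)) μ := fun μ _ =>
    (integrable_const 1).indicator hKm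
  refine ⟨infConv K h d, hmeas, fun x => ⟨h'0 x, h'1 x⟩,
    abs_infConv_sub_le hh0 hd0 (fun x y => m'.skorohodJ_symm _ _)
      (fun x y z => m'.skorohodJ_triangle _ _ _), ?_⟩
  have hP : ∫ x, h x ∂P ≤ ∫ x, infConv K h d x ∂P + η * P.real univ + P.real Kᶜ := by
    have h3 : ∫ x, h x ∂P ≤ ∫ x, (infConv K h d x + η + Kᶜ.indicator (fun _ => (1 : ℝ)) x) ∂P := by
      refine integral_mono (hint P hh hh0 fun x => (h01 x).2)
        (((hint P hmeas h'0 h'1).add (integrable_const η)).add (hind P)) fun x => ?_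
      by_cases hx : x ∈ K
      · have : h x - η ≤ infConv K h d x := le_infConv hx (by linarith [(h01 x).2])
          fun y hy => by linarith [H m' h1 h2 (x, y) ⟨hx, hy⟩]
        simp only [indicator_of_notMem (show x ∉ Kᶜ by simpa using hx)]
        linarith
      · simp only [indicator_of_mem (show x ∈ Kᶜ from hx)]
        linarith [h'0 x, (h01 x).2]
    have h4 : Integrable (fun x => infConv K h d x + η) P :=
      (hint P hmeas h'0 h'1).add (integrable_const η)
    rw [integral_add h4 (hind P),
      integral_add (hint P hmeas h'0 h'1) (integrable_const η), integral_indicator_const _ hKm,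
      integral_const] at h3
    simpa [mul_comm] using h3
  -- No η is lost here: on `K` the choice y = x in the infimum gives at most h(x).
  have hQ : ∫ x, infConv K h d x ∂Q ≤ ∫ x, h x ∂Q + Q.real Kᶜ := by
    have h3 : ∫ x, infConv K h d x ∂Q ≤ ∫ x, (h x + Kᶜ.indicator (fun _ => (1 : ℝ)) x) ∂Q := by
      refine integral_mono (hint Q hmeas h'0 h'1)
        ((hint Q hh hh0 fun x => (h01 x).2).add (hind Q)) fun x => ?_
      by_cases hx : x ∈ K
      · simp only [indicator_of_notMem (show x ∉ Kᶜ by simpa using hx), add_zero]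
        exact infConv_le hh0 hd0 (fun x => m'.skorohodJ_self _) hx
      · simp only [indicator_of_mem (show x ∈ Kᶜ from hx)]
        linarith [h'1 x, hh0 x]
    rw [integral_add (hint Q hh hh0 fun x => (h01 x).2) (hind Q),
      integral_indicator_const _ hKm] at h3
    simpa using h3
  linarith

end PMetric

/-! ### Bounded Wasserstein supremum and standard Borel tools -/

lemma bddAbove_wasserstein {Ω : Type*} [MeasurableSpace Ω] (d : Ω → Ω → ℝ) (P Q : Measure Ω)
    [IsFiniteMeasure P] :
    BddAbove {r : ℝ | ∃ h : Ω → ℝ, Measurable h ∧ (∀ x, 0 ≤ h x ∧ h x ≤ 1) ∧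
      (∀ x y, |h x - h y| ≤ d x y) ∧ r = ∫ x, h x ∂P - ∫ x, h x ∂Q} := by
  refine ⟨P.real univ, ?_⟩
  rintro _ ⟨h, hh, h01, -, rfl⟩
  have h1 : ∫ x, h x ∂P ≤ ∫ _, (1 : ℝ) ∂P := by
    refine integral_mono (Integrable.of_bound hh.aestronglyMeasurable 1 (ae_of_all _ fun x => ?_))
      (integrable_const 1) fun x => (h01 x).2
    rw [Real.norm_of_nonneg (h01 x).1]
    exact (h01 x).2
  have h2 : 0 ≤ ∫ x, h x ∂Q := integral_nonneg fun x => (h01 x).1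
  simp only [integral_const, smul_eq_mul, mul_one] at h1
  linarith

/-- The summands embed openly, so a set with Borel slices is a countable union of Borel images. -/
instance Sigma.borelSpace_of_countable {ι : Type*} [Countable ι] {β : ι → Type*}
    [∀ i, TopologicalSpace (β i)] [∀ i, MeasurableSpace (β i)] [∀ i, BorelSpace (β i)] :
    BorelSpace (Σ i, β i) := by
  refine ⟨le_antisymm ?_ ?_⟩
  · intro s hs
    have hs : ∀ i, MeasurableSet (Sigma.mk i ⁻¹' s) := fun i =>
      MeasurableSpace.measurableSet_iInf.1 hs i
    have h : s = ⋃ i, Sigma.mk i '' (Sigma.mk i ⁻¹' s) := by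
      ext z
      simp only [mem_iUnion, mem_image, mem_preimage]
      exact ⟨fun hz => ⟨z.1, z.2, hz, rfl⟩, fun ⟨_, _, hx, hz⟩ => hz ▸ hx⟩
    rw [h]
    let _ : MeasurableSpace (Σ i, β i) := borel _
    have : BorelSpace (Σ i, β i) := ⟨rfl⟩
    exact MeasurableSet.iUnion fun i =>
      IsOpenEmbedding.sigmaMk.measurableEmbedding.measurableSet_image.2 (hs i)
  · refine MeasurableSpace.generateFrom_le fun s hs => MeasurableSpace.measurableSet_iInf.2 fun i =>
      ?_
    exact (hs.preimage continuous_sigmaMk : IsOpen (Sigma.mk i ⁻¹' s)).measurableSet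

lemma MeasurableEquiv.standardBorelSpace {α β : Type*} [MeasurableSpace α] [MeasurableSpace β]
    [h : StandardBorelSpace β] (e : α ≃ᵐ β) : StandardBorelSpace α := by
  obtain ⟨t, hb, _⟩ := h.polish
  refine ⟨t.induced e, @BorelSpace.mk _ (t.induced e) _ ?_, e.toEquiv.polishSpace_induced⟩
  rw [borel_comap, ← hb.measurable_eq, e.measurableEmbedding.comap_eq]

/-! ### Traces as a standard Borel space and measurability of paths -/

namespace GSMP

variable {AP S E : Type*} [Fintype S] (M : GSMP AP S E)

instance : StandardBorelSpace M.Config :=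
  let _ : TopologicalSpace S := ⊥
  inferInstance

/-- Traces embed measurably as a Borel subset of the sequences of configurations. -/
instance : StandardBorelSpace M.Trace := by
  have := M.measurableEmbedding_traceVal
  have h : StandardBorelSpace (range M.traceVal) := this.measurableSet_range.standardBorel
  exact this.equivRange.standardBorelSpace

/-- Joint measurability is needed because the elapsed time t − σₙ depends on the trace. It is
checked separately on the finitely many pieces with fixed state. -/
lemma measurable_evolve_uncurry :
    Measurable fun z : M.Config × ℝ≥0 => M.evolve z.1 z.2 := by
  intro A hA
  have he : ∀ s, MeasurableEmbedding fun z : (M.I s → ℝ≥0) × ℝ≥0 =>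
      ((⟨s, z.1⟩, z.2) : M.Config × ℝ≥0) := fun s =>
    (IsOpenEmbedding.sigmaMk (σ := fun s => M.I s → ℝ≥0) (i := s)).measurableEmbedding.prodMap
      MeasurableEmbedding.id
  have h : (fun z : M.Config × ℝ≥0 => M.evolve z.1 z.2) ⁻¹' A =
      ⋃ s, (fun z : (M.I s → ℝ≥0) × ℝ≥0 => ((⟨s, z.1⟩, z.2) : M.Config × ℝ≥0)) ''
        {z | M.evolve ⟨s, z.1⟩ z.2 ∈ A} := by
    ext ⟨⟨s, c⟩, t⟩
    simp only [mem_preimage, mem_iUnion, mem_image, mem_ofPred_eq, Prod.exists]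
    constructor
    · exact fun h => ⟨s, c, t, h, rfl⟩
    · rintro ⟨s', c', t', h, heq⟩
      have e : M.evolve ⟨s', c'⟩ t' = M.evolve ⟨s, c⟩ t :=
        congrArg (fun z : M.Config × ℝ≥0 => M.evolve z.1 z.2) heq
      exact e ▸ h
  rw [h]
  refine MeasurableSet.iUnion fun s => (he s).measurableSet_image.2 ?_
  have hm : Measurable fun z : (M.I s → ℝ≥0) × ℝ≥0 => M.evolve ⟨s, z.1⟩ z.2 := by
    refine (measurable_sigmaMk s).comp (measurable_pi_lambda _ fun i => ?_)
    have h1 : Measurable fun z : (M.I s → ℝ≥0) × ℝ≥0 => z.1 i :=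
      (measurable_pi_apply i).comp measurable_fst
    have h2 : Measurable fun z : (M.I s → ℝ≥0) × ℝ≥0 => M.fireTime ⟨s, z.1⟩ :=
      (measurable_fireTime.comp (measurable_sigmaMk s)).comp measurable_fst
    exact h1.sub ((measurable_snd.min h2).const_mul (M.rate s i))
  exact hm hA

lemma measurable_entryTime (n : ℕ) : Measurable fun τ : M.Trace => M.entryTime τ.1 n :=
  Finset.measurable_sum _ fun k _ => measurable_fireTime.comp
    (measurable_subtype_coe.comp ((measurable_pi_apply k).comp measurable_subtype_coe))

lemma measurable_path (t : ℝ≥0) : Measurable fun τ : M.Trace => M.path τ t := by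
  classical
  -- Divergence of the entry times makes the index set in `path` nonempty, so its `sInf` is a true
  -- minimum and a measurable function of the trace.
  have hex : ∀ τ : M.Trace, ∃ n, t < M.entryTime τ.1 (n + 1) := fun τ =>
    ((tendsto_add_atTop_iff_nat 1).2 τ.2 |>.eventually_gt_atTop t).exists
  have hN : Measurable fun τ : M.Trace => Nat.find (hex τ) :=
    measurable_find _ fun n => measurableSet_lt measurable_const (M.measurable_entryTime (n + 1))
  have hF : Measurable fun z : ℕ × M.Trace =>
      M.evolve (z.2.1 z.1).1 (t - M.entryTime z.2.1 z.1) := by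
    refine measurable_from_prod_countable_right fun n => ?_
    exact M.measurable_evolve_uncurry.comp
      ((measurable_subtype_coe.comp ((measurable_pi_apply n).comp measurable_subtype_coe)).prodMk
        (measurable_const.sub (M.measurable_entryTime n)))
  have h := (hF.comp (hN.prodMk measurable_id)).subtype_mk
    (h := fun τ => isGenState_evolve (τ.1 (Nat.find (hex τ))).2 _)
  convert! h using 2 with τ
  have hs : sInf {n : ℕ | t < M.entryTime τ.1 (n + 1)} = Nat.find (hex τ) := Nat.sInf_def (hex τ)
  apply Subtype.ext
  simp only [path, hs, Function.comp, id]

instance (x : M.Config) : IsProbabilityMeasure (M.seqLaw x) := by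
  unfold seqLaw
  infer_instance

instance (g : M.GenState) : IsFiniteMeasure (M.traceLaw g) := by
  unfold traceLaw
  infer_instance

end GSMP

end

theorem mainTheorem4 {AP S E : Type*} [Fintype S] (M : GSMP AP S E)
    (k : ℝ) (hk0 : 0 < k) (hk1 : k < 1)
    (m : PMetric M.GenState) (hm : m.HasCountableBasis)
    (hmeas : ∀ a, Measurable (m.d a))
    (hcadlag : ∀ τ : M.Trace, m.IsCadlag (M.path τ))
    (g g' : M.GenState) (δ : ℝ) (hδ : δ < M.F k m g g') :
    ∃ (Gfin : Finset M.GenState) (ε : ℝ), 0 < ε ∧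
      ∀ m' : PMetric M.GenState, m.Preceq m' →
        (∀ a ∈ Gfin, ∀ b ∈ Gfin, m.d a b - ε ≤ m'.d a b) →
        δ < M.F k m' g g' := by
  have : Nonempty M.GenState := ⟨g⟩
  have hlt : δ / k < wasserstein (M.traceJ m) (M.traceLaw g) (M.traceLaw g') := by
    rw [div_lt_iff₀ hk0, mul_comm]
    exact hδ
  -- The zero function shows that the supremum is over a nonempty set.
  obtain ⟨_, ⟨h, hh, h01, hlip, rfl⟩, hc⟩ := exists_lt_of_lt_csSup
    (by exact ⟨0, fun _ => 0, measurable_const, by simp, fun x y => by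
      simpa [GSMP.traceJ] using m.skorohodJ_nonneg (M.path x) (M.path y), by simp⟩) hlt
  obtain ⟨G, ε, hε, H⟩ := PMetric.exists_finset_forall_exists_lt_integral_sub (M.traceLaw g)
    (M.traceLaw g') hm hcadlag (fun a t => (hmeas a).comp (M.measurable_path t)) hh h01 hlip hc
  refine ⟨G, ε, hε, fun m' h1 h2 => ?_⟩
  obtain ⟨h', hh', h01', hlip', hc'⟩ := H m' h1 h2
  have := hc'.trans_le (le_csSup (bddAbove_wasserstein (M.traceJ m') (M.traceLaw g)
    (M.traceLaw g')) ⟨h', hh', h01', hlip', rfl⟩)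
  rw [div_lt_iff₀ hk0, mul_comm] at this
  exact this
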